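/- Let $(X,d)$ be a metric space and $\alpha=(\alpha_i)_{i\in\mathbb N}$ a sequence in $X$ with dense range such that $(i,j)\mapsto d(\alpha_i,\alpha_j)$ is a computable function $\mathbb N^2\to\mathbb R$ (i.e. there is a computable $F:\mathbb N^3\to\mathbb Q$ with $|d(\alpha_i,\alpha_j)-F(i,j,k)|<2^{-k}$ for all $i,j,k$); so $(X,d,\alpha)$ is a computable metric space. Let $(I_i)_{i\in\mathbb N}$ be a standard computable enumeration of the open balls with centre some $\alpha_m$ and positive rational radius, and $(J_j)_{j\in\mathbb N}$ a standard computable enumeration of the unions of nonempty finite families of such balls. A closed set $S\subseteq X$ is *c.e.* if $\{i : S\cap I_i\neq\emptyset\}$ is a computably enumerable subset of $\mathbb N$; it is *co-c.e.* if $X\setminus S=\bigcup_{i\in A}I_i$ for some computably enumerable (possibly empty) set $A\subseteq\mathbb N$; it is *computable* if it is both c.e. and co-c.e. A compact set $K\subseteq X$ is *computably compact* if it is c.e. and $\{j : K\subseteq J_j\}$ is computably enumerable. The space $(X,d,\alpha)$ is *locally computable* if every compact subset of $X$ is contained in a computably compact set. **Theorem.** Let $(X,d,\alpha)$ be a computable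 metric space which is locally computable. Let $n\ge 1$, let $E\subseteq X$ be an $n$-cell, i.e. there is a homeomorphism $f:B^n\to E$ from the closed Euclidean unit ball $B^n\subseteq\mathbb R^n$, and let $f(S^{n-1})$ be its boundary sphere, where $S^{n-1}=\{x\in\mathbb R^n : \|x\|=1\}$. If $E$ and $f(S^{n-1})$ are both co-c.e. in $(X,d,\alpha)$, then $E$ is computable in $(X,d,\alpha)$. -/

import Mathlib

namespace CompMetric

/-- A function into `ℚ` is computable if it is `(-1)^c * a / (b + 1)` for computable `a, b, c`. -/
def ComputableRat {A : Type*} [Primcodable A] (F : A → ℚ) : Prop :=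
  ∃ a b c : A → ℕ, Computable a ∧ Computable b ∧ Computable c ∧
    ∀ x, F x = (-1) ^ c x * ((a x : ℚ) / ((b x : ℚ) + 1))

/-- A function into `ℝ` is computable if it is effectively approximated by a computable
rational-valued function. -/
def ComputableReal {A : Type*} [Primcodable A] (f : A → ℝ) : Prop :=
  ∃ F : A × ℕ → ℚ, ComputableRat F ∧ ∀ x i, |f x - (F (x, i) : ℝ)| < (2 : ℝ)⁻¹ ^ i

/-- `(X, d, α)` is a computable metric space, `d` being the distance of `X`. -/
structure IsComputableMetricSpace {X : Type*} [MetricSpace X] (α : ℕ → X) : Prop where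
  dense : DenseRange α
  computable_dist : ComputableReal (fun p : ℕ × ℕ => dist (α p.1) (α p.2))

/-- A computable enumeration of the positive rational numbers. -/
def posRat (i : ℕ) : ℚ := ((i.unpair.1 : ℚ) + 1) / ((i.unpair.2 : ℚ) + 1)

section

variable {X : Type*} [MetricSpace X] (α : ℕ → X)

/-- The `i`-th open rational ball `I i`. -/
def ratBall (i : ℕ) : Set X := Metric.ball (α i.unpair.1) (posRat i.unpair.2 : ℝ)

/-- The `j`-th nonempty finite sequence of natural numbers. -/
def finSeq (j : ℕ) : List ℕ := j.unpair.1 :: Denumerable.ofNat (List ℕ) j.unpair.2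

/-- The `j`-th finite union of rational balls `J j`. -/
def ratUnion (j : ℕ) : Set X := ⋃ i ∈ finSeq j, ratBall α i

/-- A closed set is computably enumerable if the rational balls that meet it form a c.e. set. -/
def IsCE (S : Set X) : Prop :=
  IsClosed S ∧ REPred (fun i : ℕ => (S ∩ ratBall α i).Nonempty)

/-- A closed set is co-computably enumerable if its complement is the union of a c.e. family of
rational balls. (A nonempty c.e. family is the range of a computable sequence; the empty family
is needed for `S = X`, since rational balls are nonempty.) -/
def IsCoCE (S : Set X) : Prop :=
  IsClosed S ∧ ∃ A : Set ℕ, REPred (fun i : ℕ => i ∈ A) ∧ Sᶜ = ⋃ i ∈ A, ratBall α i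

/-- A set is computable if it is both c.e. and co-c.e. -/
def IsComputableSet (S : Set X) : Prop := IsCE α S ∧ IsCoCE α S

/-- Computably compact sets. -/
def IsComputablyCompact (K : Set X) : Prop :=
  IsCompact K ∧ IsCE α K ∧ REPred (fun j : ℕ => K ⊆ ratUnion α j)

/-- Local computability: every compact set lies in a computably compact set. -/
def IsLocallyComputable : Prop :=
  ∀ A : Set X, IsCompact A → ∃ K : Set X, IsComputablyCompact α K ∧ A ⊆ K

end

/-- The unit ball `B^n` of Euclidean `n`-space, with its subspace topology. -/
abbrev UnitBall (n : ℕ) : Type :=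
  Metric.closedBall (0 : EuclideanSpace ℝ (Fin n)) 1

/-- The boundary sphere `f (S^(n-1))` of an `n`-cell `E`, where `f : B^n → E` is a
homeomorphism. -/
def boundarySphere {X : Type*} [TopologicalSpace X] {n : ℕ} {E : Set X}
    (f : UnitBall n ≃ₜ E) : Set X :=
  {x | ∃ y : UnitBall n, ‖(y : EuclideanSpace ℝ (Fin n))‖ = 1 ∧ (f y : X) = x}

end CompMetric

/-! Only the c.e. half needs proof: meeting `ratBall α i` must be certified by a finite,
semidecidable witness.

Finite covers are semidecidable. Enclose the compact co-c.e. set `E` in a computably compact `K`;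
then `l` covers `E` exactly when `l` and finitely many balls of the complement of `E` cover `K`
(`IsCoCE.rePred_subset_cover`). The same holds for the boundary sphere.

The witness is a `SeparatesFaces` list: balls covering `E` outside `ratBall α i`, labelled by the 2n
signed coordinates, opposite labels being disjoint and the labels respecting the faces along the
sphere. If `E` missed `ratBall α i`, such a list would give a nowhere zero vector field on the
closed ball that never points to the centre on the sphere, against Brouwer
(`SeparatesFaces.inter_ratBall_nonempty`). Conversely, if `E` meets the ball, it does so at the
image of an interior point `p`. A field with `p` as only zero, equal to the identity on the sphere,
labels the remaining points by a coordinate in which it is large (`exists_separatesFaces`).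

Brouwer is proved analytically, from the Jacobian integral of a supposed smooth retraction onto the
sphere. -/

section REPred

/-! ### Closure properties of r.e. predicates -/

open Nat.Partrec (Code)

variable {α β γ : Type*} [Primcodable α] [Primcodable β] [Primcodable γ]

/-- A predicate that is the projection of a decidable one along `ℕ` is r.e. -/
theorem REPred.of_exists_nat {g : α → ℕ → Bool} (hg : Computable₂ g) :
    REPred fun a => ∃ k, g a k = true := by
  have h : Partrec fun a => Nat.rfind fun k => Part.some (g a k) := Partrec.rfind hg.partrec₂
  refine h.dom_re.of_eq fun a => ?_
  refine Nat.rfind_dom.trans ⟨fun ⟨k, hk, _⟩ => ⟨k, (Part.mem_some_iff.1 hk).symm⟩, ?_⟩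
  rintro ⟨k, hk⟩
  exact ⟨k, Part.mem_some_iff.2 hk.symm, fun _ => _root_.trivial⟩

/-- An r.e. predicate is the projection of an increasing primitive recursive one along `ℕ`. -/
theorem REPred.exists_primrec {p : α → Prop} (hp : REPred p) :
    ∃ g : α → ℕ → Bool, Primrec₂ g ∧ (∀ a k l, k ≤ l → g a k = true → g a l = true) ∧
      ∀ a, p a ↔ ∃ k, g a k = true := by
  obtain ⟨c, hc⟩ := Code.exists_code.1 hp
  refine ⟨fun a k => (Code.evaln k c (Encodable.encode a)).isSome, ?_, ?_, ?_⟩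
  · refine Primrec.option_isSome.comp (Code.primrec_evaln.comp
      ((Primrec.snd.pair (Primrec.const c)).pair (Primrec.encode.comp Primrec.fst)))
  · intro a k l hkl h
    obtain ⟨x, hx⟩ := Option.isSome_iff_exists.1 h
    exact Option.isSome_iff_exists.2 ⟨x, Code.evaln_mono hkl hx⟩
  · intro a
    have h1 : p a ↔ (Code.eval c (Encodable.encode a)).Dom := by
      rw [hc]
      simp [Part.assert]
    rw [h1, Part.dom_iff_mem]
    simp only [Code.evaln_complete, Option.isSome_iff_exists, Option.mem_def]
    exact exists_comm

theorem REPred.comp {p : β → Prop} (hp : REPred p) {f : α → β} (hf : Computable f) :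
    REPred fun a => p (f a) :=
  Partrec.comp hp hf

theorem REPred.comp₂ {p : β → γ → Prop} (hp : REPred fun x : β × γ => p x.1 x.2) {f : α → β}
    {g : α → γ} (hf : Computable f) (hg : Computable g) : REPred fun a => p (f a) (g a) :=
  REPred.comp hp (hf.pair hg)

theorem REPred.and {p q : α → Prop} (hp : REPred p) (hq : REPred q) :
    REPred fun a => p a ∧ q a := by
  obtain ⟨g, hg, gm, gp⟩ := hp.exists_primrec
  obtain ⟨h, hh, hm, hq⟩ := hq.exists_primrec
  refine (REPred.of_exists_nat (g := fun a k => g a k && h a k)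
    (Primrec.and.comp hg hh).to_comp).of_eq fun a => ?_
  rw [gp, hq]
  constructor
  · rintro ⟨k, hk⟩
    simp only [Bool.and_eq_true] at hk
    exact ⟨⟨k, hk.1⟩, k, hk.2⟩
  · rintro ⟨⟨k, hk⟩, l, hl⟩
    exact ⟨max k l, by simp [gm a k _ (le_max_left k l) hk, hm a l _ (le_max_right k l) hl]⟩

theorem REPred.or {p q : α → Prop} (hp : REPred p) (hq : REPred q) :
    REPred fun a => p a ∨ q a := by
  obtain ⟨g, hg, gm, gp⟩ := hp.exists_primrec
  obtain ⟨h, hh, hm, hq⟩ := hq.exists_primrec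
  refine (REPred.of_exists_nat (g := fun a k => g a k || h a k)
    (Primrec.or.comp hg hh).to_comp).of_eq fun a => ?_
  rw [gp, hq, ← exists_or]
  simp

/-- R.e. predicates are closed under projections. -/
theorem REPred.exists {p : α × β → Prop} (hp : REPred p) : REPred fun a => ∃ b, p (a, b) := by
  obtain ⟨g, hg, -, gp⟩ := hp.exists_primrec
  -- Dovetailing: `m` codes both a candidate `b` and a stage; numbers that decode to no `b` are
  -- rejected.
  have hc : Primrec₂ fun (a : α) (m : ℕ) =>
      ((Encodable.decode (α := β) m.unpair.1).map fun b => g (a, b) m.unpair.2).getD false := by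
    refine Primrec.option_getD.comp (Primrec.option_map (Primrec.decode.comp
      (Primrec.fst.comp (Primrec.unpair.comp Primrec.snd))) ?_) (Primrec.const false)
    exact hg.comp ((Primrec.fst.comp Primrec.fst).pair Primrec.snd)
      (Primrec.snd.comp (Primrec.unpair.comp (Primrec.snd.comp Primrec.fst)))
  refine (REPred.of_exists_nat hc.to_comp).of_eq fun a => ?_
  constructor
  · rintro ⟨m, hm⟩
    cases hb : Encodable.decode (α := β) m.unpair.1 with
    | none => simp [hb] at hm
    | some b => exact ⟨b, (gp _).2 ⟨m.unpair.2, by simpa [hb] using hm⟩⟩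
  · rintro ⟨b, hb⟩
    obtain ⟨k, hk⟩ := (gp _).1 hb
    exact ⟨Nat.pair (Encodable.encode b) k, by simpa using hk⟩

/-- R.e. predicates are closed under universal quantification over the entries of a list. -/
theorem REPred.forall_mem_list {p : β × γ → Prop} (hp : REPred p) :
    REPred fun x : List β × γ => ∀ b ∈ x.1, p (b, x.2) := by
  obtain ⟨g, hg, gm, gp⟩ := hp.exists_primrec
  have hR : PrimrecRel fun (b : β) (y : γ × ℕ) => g (b, y.1) y.2 = Bool.true := by
    have h : Primrec fun z : β × γ × ℕ => g (z.1, z.2.1) z.2.2 :=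
      hg.comp (Primrec.fst.pair (Primrec.fst.comp Primrec.snd)) (Primrec.snd.comp Primrec.snd)
    exact Primrec.eq.comp h (Primrec.const Bool.true)
  have hA : PrimrecPred fun z : (List β × γ) × ℕ => ∀ b ∈ z.1.1, g (b, z.1.2) z.2 = Bool.true :=
    hR.forall_mem_list.comp (Primrec.fst.comp Primrec.fst)
      ((Primrec.snd.comp Primrec.fst).pair Primrec.snd)
  obtain ⟨dec, hdec⟩ := hA
  have hdec' : Computable₂ fun (x : List β × γ) (k : ℕ) => @decide _ (dec (x, k)) :=
    hdec.to_comp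
  refine (REPred.of_exists_nat hdec').of_eq fun ⟨l, c⟩ => ?_
  simp only [decide_eq_true_eq]
  constructor
  · rintro ⟨k, hk⟩ b hb
    exact (gp _).2 ⟨k, hk b hb⟩
  · intro h
    induction l with
    | nil => exact ⟨0, by simp⟩
    | cons b l ih =>
      obtain ⟨k, hk⟩ := ih fun b hb => h b (List.mem_cons_of_mem _ hb)
      obtain ⟨m, hm⟩ := (gp _).1 (h b List.mem_cons_self)
      -- Stages are monotone, so one stage serves the whole list.
      refine ⟨max k m, fun b' hb' => ?_⟩
      rcases List.mem_cons.1 hb' with rfl | hb'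
      · exact gm _ _ _ (le_max_right k m) hm
      · exact gm _ _ _ (le_max_left k m) (hk b' hb')

theorem REPred.forall_mem_list₂ {p : β × γ → Prop} (hp : REPred p) :
    REPred fun x : List β × List γ => ∀ b ∈ x.1, ∀ c ∈ x.2, p (b, c) := by
  have h1 : REPred fun y : γ × β => p (y.2, y.1) := hp.comp (Computable.snd.pair Computable.fst)
  have h2 : REPred fun y : β × List γ => ∀ c ∈ y.2, p (y.1, c) :=
    h1.forall_mem_list.comp (Computable.snd.pair Computable.fst)
  exact h2.forall_mem_list

theorem REPred.ne {f g : α → β} (hf : Primrec f) (hg : Primrec g) :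
    REPred fun a => ¬ f a = g a := by
  classical
  exact (Primrec.eq.comp hf hg).not.computablePred.to_re

theorem REPred.trivial : REPred fun _ : α => True :=
  (REPred.of_exists_nat (g := fun _ _ => true) (Computable.const true)).of_eq fun a => by simp

/-- R.e. predicates are closed under finite conjunctions. -/
theorem REPred.forall_fintype {ι : Type*} [Finite ι] {p : ι → α → Prop}
    (hp : ∀ i, REPred (p i)) : REPred fun a => ∀ i, p i a := by
  classical
  have := Fintype.ofFinite ι
  have key : ∀ s : Finset ι, REPred fun a => ∀ i ∈ s, p i a := by
    intro s
    induction s using Finset.induction_on with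
    | empty => exact REPred.trivial.of_eq fun a => by simp
    | insert i s _ ih => exact ((hp i).and ih).of_eq fun a => by simp
  exact (key Finset.univ).of_eq fun a => by simp

end REPred

/-! ### Brouwer's fixed point theorem -/

section Brouwer

open MeasureTheory Metric Set Module

variable {V : Type*} [NormedAddCommGroup V] [InnerProductSpace ℝ V]

theorem ker_one_add_smul_eq_bot {A : V →L[ℝ] V} {L s : ℝ} (hA : ‖A‖ ≤ L) (hs : 0 ≤ s)
    (hsL : s * L < 1) : LinearMap.ker ((1 + s • A : V →L[ℝ] V) : V →ₗ[ℝ] V) = ⊥ := by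
  rw [LinearMap.ker_eq_bot']
  intro w hw
  have hw' : w + s • A w = 0 := hw
  by_contra hne
  have h0 : 0 < ‖w‖ := norm_pos_iff.2 hne
  have h1 : ‖w‖ = s * ‖A w‖ := by
    rw [eq_neg_of_add_eq_zero_left hw', norm_neg, norm_smul, Real.norm_of_nonneg hs,
      ← eq_neg_of_add_eq_zero_left hw']
  have h2 : ‖A w‖ ≤ L * ‖w‖ := (A.le_opNorm w).trans (by gcongr)
  nlinarith [mul_le_mul_of_nonneg_left h2 hs]

variable [FiniteDimensional ℝ V]

/-- `det (1 + t A)` is a polynomial in `t` of degree at most the dimension, hence is recovered from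
its values at `dim + 1` nodes. -/
theorem det_one_add_smul_eq_sum_lagrange (A : V →L[ℝ] V) {v : Fin (finrank ℝ V + 1) → ℝ}
    (hv : Function.Injective v) (t : ℝ) :
    (1 + t • A).det =
      ∑ i, (Lagrange.basis Finset.univ v i).eval t * (1 + v i • A).det := by
  classical
  let b := finBasis ℝ V
  let M := LinearMap.toMatrix b b (A : V →ₗ[ℝ] V)
  let Q : Polynomial ℝ :=
    Matrix.det ((Polynomial.X : Polynomial ℝ) • M.map Polynomial.C +
      (1 : Matrix _ _ ℝ).map Polynomial.C)
  have hQ : ∀ s : ℝ, (1 + s • A).det = Q.eval s := by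
    intro s
    have h1 : (1 + s • A).det = Matrix.det (1 + s • M) := by
      rw [ContinuousLinearMap.det, ← LinearMap.det_toMatrix b]
      congr 1
      have : ((1 + s • A : V →L[ℝ] V) : V →ₗ[ℝ] V) = LinearMap.id + s • (A : V →ₗ[ℝ] V) := rfl
      rw [this, map_add, map_smul, LinearMap.toMatrix_id]
    rw [h1, ← Polynomial.coe_evalRingHom, RingHom.map_det]
    congr 1
    ext i j
    simp [Matrix.one_apply, add_comm, M]
    split_ifs <;> simp [mul_comm]
  have hdeg : Q.degree < (Finset.univ : Finset (Fin (finrank ℝ V + 1))).card := by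
    refine (Polynomial.degree_le_natDegree).trans_lt ?_
    have := Polynomial.natDegree_det_X_add_C_le M (1 : Matrix _ _ ℝ)
    simp only [Fintype.card_fin, Finset.card_univ] at this ⊢
    exact_mod_cast Nat.lt_succ_of_le this
  have h := Lagrange.eq_interpolate (f := Q) (hv.injOn) hdeg
  rw [hQ, congrArg (Polynomial.eval t) h, Lagrange.interpolate_apply,
    Polynomial.eval_finsetSum]
  refine Finset.sum_congr rfl fun i _ => ?_
  rw [hQ, Polynomial.eval_mul, Polynomial.eval_C, mul_comm]

/-- The determinant is 1 at parameter 0 and does not vanish up to `t`, so it cannot change sign. -/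
theorem det_one_add_smul_pos {A : V →L[ℝ] V} {L t : ℝ} (hA : ‖A‖ ≤ L) (ht : 0 ≤ t)
    (htL : t * L < 1) : 0 < (1 + t • A).det := by
  have hL : 0 ≤ L := (norm_nonneg A).trans hA
  have hne : ∀ s ∈ Icc 0 t, (1 + s • A).det ≠ 0 := by
    intro s hs h0
    refine (LinearMap.bot_lt_ker_of_det_eq_zero h0).ne' (ker_one_add_smul_eq_bot hA hs.1 ?_)
    nlinarith [hs.2]
  have hcont : Continuous fun s : ℝ => (1 + s • A).det :=
    ContinuousLinearMap.continuous_det.comp (by fun_prop)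
  by_contra! hle
  obtain ⟨s, hs, h0⟩ := intermediate_value_Icc' ht hcont.continuousOn
    (show (0 : ℝ) ∈ Icc ((1 + t • A).det) ((1 + (0 : ℝ) • A).det) from
      ⟨hle, by simp [ContinuousLinearMap.det]⟩)
  exact hne s hs h0

/-- A small perturbation `x + t g x` of the identity maps the unit ball bijectively onto itself, if
it fixes the sphere and maps the ball to itself, so its Jacobian has integral the volume. -/
theorem integral_det_one_add_smul_eq_volume [MeasurableSpace V] [BorelSpace V] {g : V → V}
    {A : V → V →L[ℝ] V} {L t : ℝ}
    (hg : ∀ x ∈ closedBall (0 : V) 1, HasStrictFDerivAt g (A x) x)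
    (hA : ∀ x ∈ closedBall (0 : V) 1, ‖A x‖ ≤ L)
    (hS : ∀ x : V, ‖x‖ = 1 → g x = 0) (hB : ∀ x ∈ ball (0 : V) 1, ‖x + t • g x‖ < 1)
    (ht : 0 ≤ t) (htL : t * L < 1) :
    ∫ x in ball (0 : V) 1, (1 + t • A x).det = volume.real (ball (0 : V) 1) := by
  set F : V → V := fun x => x + t • g x with hF
  have hF' : ∀ x ∈ closedBall (0 : V) 1, HasStrictFDerivAt F (1 + t • A x) x := fun x hx =>
    (hasStrictFDerivAt_id x).add ((hg x hx).const_smul t)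
  have hsub : ball (0 : V) 1 ⊆ closedBall 0 1 := ball_subset_closedBall
  have hlip : ∀ x ∈ closedBall (0 : V) 1, ∀ y ∈ closedBall (0 : V) 1,
      ‖g y - g x‖ ≤ L * ‖y - x‖ := fun x hx y hy =>
    (convex_closedBall 0 1).norm_image_sub_le_of_norm_hasFDerivWithin_le
      (fun z hz => (hg z hz).hasFDerivAt.hasFDerivWithinAt) hA hx hy
  have hinj : InjOn F (closedBall 0 1) := by
    intro x hx y hy hxy
    by_contra hne
    have h0 : 0 < ‖y - x‖ := norm_pos_iff.2 (sub_ne_zero.2 (Ne.symm hne))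
    have h1 : y - x = -(t • (g y - g x)) := by
      have : x + t • g x = y + t • g y := hxy
      rw [smul_sub, neg_sub, sub_eq_sub_iff_add_eq_add, ← this, add_comm]
    have h2 : ‖y - x‖ = t * ‖g y - g x‖ := by
      conv_lhs => rw [h1]
      rw [norm_neg, norm_smul, Real.norm_of_nonneg ht]
    nlinarith [mul_le_mul_of_nonneg_left (hlip x hx y hy) ht]
  have hopen : IsOpen (F '' ball 0 1) := by
    rw [isOpen_iff_mem_nhds]
    rintro _ ⟨x, hx, rfl⟩
    have hsurj : LinearMap.range ((1 + t • A x : V →L[ℝ] V) : V →ₗ[ℝ] V) = ⊤ :=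
      LinearMap.ker_eq_bot_iff_range_eq_top.1
        (ker_one_add_smul_eq_bot (hA x (hsub hx)) ht htL)
    rw [← (hF' x (hsub hx)).map_nhds_eq_of_surj hsurj]
    exact Filter.image_mem_map (isOpen_ball.mem_nhds hx)
  -- The image is open, and relatively closed in the ball because limit points come from the closed
  -- ball, whose sphere is fixed; the ball being connected, the image is all of it.
  have himage : F '' ball 0 1 = ball 0 1 := by
    apply Subset.antisymm
    · rintro _ ⟨x, hx, rfl⟩
      simpa using hB x hx
    · have h0 : (0 : V) ∈ ball (0 : V) 1 := by simp
      refine (convex_ball (0 : V) 1).isPreconnected.subset_of_closure_inter_subset hopen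
        ⟨F 0, mem_ball_zero_iff.2 (hB 0 h0), 0, h0, rfl⟩ ?_
      rintro z ⟨hz, hz1⟩
      have hcomp : IsCompact (F '' closedBall 0 1) :=
        (isCompact_closedBall 0 1).image_of_continuousOn
          fun x hx => (hF' x hx).continuousAt.continuousWithinAt
      obtain ⟨x, hx, rfl⟩ := closure_minimal (image_mono hsub) hcomp.isClosed hz
      refine ⟨x, ?_, rfl⟩
      by_contra hx'
      have hx1 : ‖x‖ = 1 := le_antisymm (by simpa using hx) (by simpa using hx')
      have : F x = x := by simp [hF, hS x hx1]
      rw [this] at hz1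
      exact hx' hz1
  have h := integral_image_eq_integral_abs_det_fderiv_smul volume (measurableSet_ball)
    (fun x hx => (hF' x (hsub hx)).hasFDerivAt.hasFDerivWithinAt) (hinj.mono hsub)
    (fun _ => (1 : ℝ))
  rw [himage] at h
  rw [setIntegral_const, smul_eq_mul, mul_one] at h
  rw [h]
  refine setIntegral_congr_fun measurableSet_ball fun x hx => ?_
  simp [abs_of_pos (det_one_add_smul_pos (hA x (hsub hx)) ht htL)]

/-- There is no `C^1` retraction of the unit ball onto the unit sphere. -/
theorem not_exists_contDiff_retraction (r : V → V)
    (hr : ∀ x ∈ closedBall (0 : V) 1, ContDiffAt ℝ 1 r x)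
    (hr1 : ∀ x ∈ closedBall (0 : V) 1, ‖r x‖ = 1) (hrS : ∀ x : V, ‖x‖ = 1 → r x = x) : False := by
  borelize V
  set g : V → V := fun x => r x - x with hgdef
  set A : V → V →L[ℝ] V := fderiv ℝ g
  have hgC : ∀ x ∈ closedBall (0 : V) 1, ContDiffAt ℝ 1 g x := fun x hx =>
    (hr x hx).sub contDiffAt_id
  have hg : ∀ x ∈ closedBall (0 : V) 1, HasStrictFDerivAt g (A x) x := fun x hx =>
    (hgC x hx).hasStrictFDerivAt one_ne_zero
  have hAc : ContinuousOn A (closedBall 0 1) := fun x hx =>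
    ((hgC x hx).fderiv_right (m := 0) (by simp)).continuousAt.continuousWithinAt
  obtain ⟨L, hL⟩ := (isCompact_closedBall (0 : V) 1).exists_bound_of_continuousOn hAc
  have hL0 : 0 ≤ L := (norm_nonneg _).trans (hL 0 (by simp))
  -- Distinct nodes with `v i < 1` and `v i * L < 1`, enough for the volume identity at each.
  let v : Fin (finrank ℝ V + 1) → ℝ := fun i => 1 / ((i : ℝ) + 2 + L)
  have hv : Function.Injective v := by
    intro i j hij
    have : (i : ℝ) + 2 + L = j + 2 + L := by
      simpa [v] using hij
    exact Fin.ext (by exact_mod_cast (by linarith : (i : ℝ) = j))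
  have hvol : ∀ i, ∫ x in ball (0 : V) 1, (1 + v i • A x).det = volume.real (ball (0 : V) 1) := by
    intro i
    have hd : (0 : ℝ) < (i : ℝ) + 2 + L := by positivity
    have hv0 : 0 < v i := by simp only [v]; positivity
    have hv1 : v i < 1 := by
      simp only [v]; rw [div_lt_one hd]; linarith [(Nat.cast_nonneg i : (0 : ℝ) ≤ (i : ℕ))]
    refine integral_det_one_add_smul_eq_volume hg hL (fun x hx => by simp [hgdef, hrS x hx])
      (fun x hx => ?_) hv0.le ?_
    · have hx' : ‖x‖ < 1 := by simpa using hx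
      have : x + v i • g x = (1 - v i) • x + v i • r x := by
        simp only [hgdef]; module
      rw [this]
      refine (norm_add_le _ _).trans_lt ?_
      rw [norm_smul, norm_smul, hr1 x (ball_subset_closedBall hx), Real.norm_of_nonneg hv0.le,
        Real.norm_of_nonneg (by linarith)]
      nlinarith
    · simp only [v]
      rw [div_mul_eq_mul_div, div_lt_one hd]
      linarith [(Nat.cast_nonneg i : (0 : ℝ) ≤ (i : ℕ))]
  have hint : ∀ i, IntegrableOn (fun x => (1 + v i • A x).det) (ball (0 : V) 1) := fun i =>
    (ContinuousOn.integrableOn_compact (isCompact_closedBall 0 1)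
      (ContinuousLinearMap.continuous_det.comp_continuousOn (by fun_prop))).mono_set
      ball_subset_closedBall
  -- Interpolation carries the constant value from the small nodes to t = 1, since the Lagrange
  -- basis sums to 1.
  have h1 : ∫ x in ball (0 : V) 1, (1 + (1 : ℝ) • A x).det = volume.real (ball (0 : V) 1) := by
    simp_rw [fun x => det_one_add_smul_eq_sum_lagrange (A x) hv 1]
    rw [integral_finsetSum _ fun i _ => (hint i).const_mul _]
    simp_rw [integral_const_mul, hvol]
    rw [← Finset.sum_mul, ← Polynomial.eval_finsetSum, Lagrange.sum_basis hv.injOn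
      Finset.univ_nonempty]
    simp
  -- At t = 1 the map is `r`. As `‖r‖` is constant, the range of its derivative is orthogonal to the
  -- nonzero vector `r x`, so the determinant vanishes.
  have h2 : ∫ x in ball (0 : V) 1, (1 + (1 : ℝ) • A x).det = 0 := by
    refine setIntegral_eq_zero_of_forall_eq_zero fun x hx => ?_
    have hx' := ball_subset_closedBall hx
    have hrd : HasFDerivAt r (1 + (1 : ℝ) • A x) x := by
      have := (hasFDerivAt_id x).add (hg x hx').hasFDerivAt
      rw [one_smul]
      refine this.congr_of_eventuallyEq (Filter.Eventually.of_forall fun y => ?_)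
      simp [hgdef]
    have hsq : HasFDerivAt (fun y => ‖r y‖ ^ 2)
        (2 • (innerSL ℝ (r x)).comp (1 + (1 : ℝ) • A x)) x := hrd.norm_sq
    have hconst : HasFDerivAt (fun y => ‖r y‖ ^ 2) (0 : V →L[ℝ] ℝ) x := by
      refine (hasFDerivAt_const (1 : ℝ) x).congr_of_eventuallyEq ?_
      filter_upwards [isOpen_ball.mem_nhds hx] with y hy
      simp [hr1 y (ball_subset_closedBall hy)]
    have hzero := hsq.unique hconst
    by_contra hdet
    obtain ⟨w, hw⟩ := (LinearMap.equivOfDetNeZero _ hdet).surjective (r x)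
    have hw' : (1 + (1 : ℝ) • A x) w = r x := hw
    have h4 : 2 • inner ℝ (r x) ((1 + (1 : ℝ) • A x) w) = 0 := DFunLike.congr_fun hzero w
    rw [hw', real_inner_self_eq_norm_sq, hr1 x hx'] at h4
    norm_num at h4
  have hpos : 0 < volume.real (ball (0 : V) 1) :=
    ENNReal.toReal_pos (measure_ball_pos volume 0 one_pos).ne' measure_ball_lt_top.ne
  linarith

/-- A `C^1` self-map of the unit ball has a fixed point: otherwise moving `x` away from `P x` along
the line through both, until the sphere is reached, would be a `C^1` retraction. -/
theorem exists_fixedPoint_of_contDiff {P : V → V} (hP : ContDiff ℝ 1 P) (hP1 : ∀ x, ‖P x‖ ≤ 1) :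
    ∃ x, P x = x := by
  by_contra! hne
  set u : V → V := fun x => x - P x with hu
  have hu0 : ∀ x, 0 < ‖u x‖ ^ 2 := fun x =>
    pow_pos (norm_pos_iff.2 (sub_ne_zero.2 (hne x).symm)) 2
  set c : V → ℝ := fun x => inner ℝ x (u x) with hc
  -- A quarter of the discriminant of `‖x + s • u x‖ ^ 2 = 1` in `s`. The larger root is used; it is
  -- 0 on the sphere because `c` is positive there.
  set D : V → ℝ := fun x => c x ^ 2 + ‖u x‖ ^ 2 * (1 - ‖x‖ ^ 2) with hD
  have hcS : ∀ x : V, ‖x‖ = 1 → 0 < c x := by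
    intro x hx
    have h1 : ‖u x‖ ^ 2 = ‖x‖ ^ 2 - 2 * inner ℝ x (P x) + ‖P x‖ ^ 2 := norm_sub_sq_real x (P x)
    have h2 : c x = ‖x‖ ^ 2 - inner ℝ x (P x) := by
      simp only [hc, hu]; rw [inner_sub_right, real_inner_self_eq_norm_sq]
    have h3 := hu0 x
    have h4 : ‖P x‖ ^ 2 ≤ 1 := pow_le_one₀ (norm_nonneg _) (hP1 x)
    rw [hx] at h1 h2
    linarith
  have hD0 : ∀ x ∈ closedBall (0 : V) 1, 0 < D x := by
    intro x hx
    have hx' : ‖x‖ ≤ 1 := by simpa using hx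
    rcases hx'.lt_or_eq with h | h
    · have : 0 < 1 - ‖x‖ ^ 2 := by nlinarith [norm_nonneg x]
      have := mul_pos (hu0 x) this
      simp only [hD]; nlinarith [sq_nonneg (c x)]
    · have := pow_pos (hcS x h) 2
      simpa [hD, h] using this
  set s : V → ℝ := fun x => (-c x + √(D x)) / ‖u x‖ ^ 2 with hs
  have huC : ContDiff ℝ 1 u := contDiff_id.sub hP
  have hcC : ContDiff ℝ 1 c := contDiff_id.inner ℝ huC
  have huC2 : ContDiff ℝ 1 fun x => ‖u x‖ ^ 2 := huC.norm_sq ℝ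
  have hDC : ContDiff ℝ 1 D :=
    (hcC.pow 2).add (huC2.mul (contDiff_const.sub (contDiff_id.norm_sq ℝ)))
  refine not_exists_contDiff_retraction (fun x => x + s x • u x) ?_ ?_ ?_
  · intro x hx
    exact contDiffAt_id.add (((hcC.contDiffAt.neg.add
      (hDC.contDiffAt.sqrt (hD0 x hx).ne')).div huC2.contDiffAt (hu0 x).ne').smul huC.contDiffAt)
  · intro x hx
    have h1 : ‖x + s x • u x‖ ^ 2 = ‖x‖ ^ 2 + 2 * (s x * c x) + s x ^ 2 * ‖u x‖ ^ 2 := by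
      rw [norm_add_sq_real, inner_smul_right, norm_smul, mul_pow, Real.norm_eq_abs, sq_abs]
    have h2 : s x * ‖u x‖ ^ 2 = -c x + √(D x) := div_mul_cancel₀ _ (hu0 x).ne'
    have h3 : √(D x) ^ 2 = D x := Real.sq_sqrt (hD0 x hx).le
    have h4 : ‖x + s x • u x‖ ^ 2 = 1 := by
      have h5 : (s x * ‖u x‖ ^ 2 + c x) ^ 2 = c x ^ 2 + ‖u x‖ ^ 2 * (1 - ‖x‖ ^ 2) := by
        rw [h2, neg_add_cancel_comm, h3]
      have h6 : ‖u x‖ ^ 2 * (‖x‖ ^ 2 + 2 * (s x * c x) + s x ^ 2 * ‖u x‖ ^ 2 - 1) = 0 := by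
        linear_combination h5
      rw [h1]
      linarith [(mul_eq_zero.1 h6).resolve_left (hu0 x).ne']
    exact (sq_eq_sq₀ (norm_nonneg _) zero_le_one).1 (by rw [h4, one_pow])
  · intro x hx
    have : s x = 0 := by
      simp only [hs, hD, hx]
      rw [one_pow, sub_self, mul_zero, add_zero, Real.sqrt_sq (hcS x hx).le, neg_add_cancel,
        zero_div]
    simp [this]

/-- **Brouwer's fixed point theorem** for the closed unit ball. -/
theorem exists_fixedPoint_closedBall {F : closedBall (0 : V) 1 → V} (hF : Continuous F)
    (hF1 : ∀ x, ‖F x‖ ≤ 1) : ∃ x, F x = x := by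
  by_contra! hne
  have hπ : ∀ x : V, (max 1 ‖x‖)⁻¹ • x ∈ closedBall (0 : V) 1 := by
    intro x
    have h : 0 < max 1 ‖x‖ := lt_max_of_lt_left one_pos
    rw [mem_closedBall_zero_iff, norm_smul, norm_inv, Real.norm_of_nonneg h.le, inv_mul_le_one₀ h]
    exact le_max_right _ _
  let π : V → closedBall (0 : V) 1 := fun x => ⟨(max 1 ‖x‖)⁻¹ • x, hπ x⟩
  have hπc : Continuous π := by
    refine Continuous.subtype_mk (Continuous.smul (Continuous.inv₀ (by fun_prop) fun x => ?_)
      continuous_id) _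
    exact (lt_max_of_lt_left one_pos).ne'
  have hπid : ∀ x (hx : x ∈ closedBall (0 : V) 1), π x = ⟨x, hx⟩ := by
    intro x hx
    have : max 1 ‖x‖ = 1 := max_eq_left (by simpa using hx)
    simp [π, this]
  have hne' : ∀ x, F (π x) ≠ x := by
    intro x hx
    have hx' : x ∈ closedBall (0 : V) 1 := by
      rw [mem_closedBall_zero_iff, ← hx]
      exact hF1 _
    exact hne ⟨x, hx'⟩ (by rwa [hπid x hx'] at hx)
  have hFπ : Continuous fun x => F (π x) := hF.comp hπc
  -- Smooth approximation by convex gluing of the local constants `F (π x)`: the constraint keeps `P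
  -- x` strictly closer to `F (π x)` than `x` is, so `P` has no fixed point either.
  obtain ⟨P, hP⟩ := exists_contMDiffMap_forall_mem_convex_of_local_const (n := 1)
    (modelWithCornersSelf ℝ V)
    (t := fun x => closedBall (0 : V) 1 ∩ ball (F (π x)) (dist x (F (π x))))
    (fun x => (convex_closedBall _ _).inter (convex_ball _ _)) (fun x => by
      refine ⟨F (π x), ?_⟩
      have h : ∀ᶠ y in nhds x, dist (F (π x)) (F (π y)) < dist y (F (π y)) := by
        refine ContinuousAt.eventually_lt (by fun_prop) (by fun_prop) ?_
        rw [dist_self]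
        exact dist_pos.2 (hne' x).symm
      filter_upwards [h] with y hy
      exact ⟨by simpa using hF1 (π x), hy⟩)
  obtain ⟨x, hx⟩ := exists_fixedPoint_of_contDiff (P := P) P.contMDiff.contDiff
    fun x => by simpa using (hP x).1
  have := (hP x).2
  rw [hx, mem_ball] at this
  exact lt_irrefl _ this

/-- A vector field on the closed unit ball that nowhere on the sphere points towards the centre has
a zero. -/
theorem exists_eq_zero_of_forall_ne_neg_smul {h : closedBall (0 : V) 1 → V} (hh : Continuous h)
    (hS : ∀ x : closedBall (0 : V) 1, ‖(x : V)‖ = 1 → ∀ t : ℝ, 0 < t → h x ≠ -(t • (x : V))) :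
    ∃ x, h x = 0 := by
  by_contra! hne
  have hn : ∀ x, 0 < ‖h x‖ := fun x => norm_pos_iff.2 (hne x)
  obtain ⟨x, hx⟩ := exists_fixedPoint_closedBall (F := fun x => -(‖h x‖⁻¹ • h x))
    ((hh.norm.inv₀ fun x => (hn x).ne').smul hh).neg fun x => by
      rw [norm_neg, norm_smul, norm_inv, norm_norm, inv_mul_cancel₀ (hn x).ne']
  refine hS x ?_ ‖h x‖ (hn x) ?_
  · rw [← hx, norm_neg, norm_smul, norm_inv, norm_norm, inv_mul_cancel₀ (hn x).ne']
  · rw [← hx, smul_neg, neg_neg, smul_smul, mul_inv_cancel₀ (hn x).ne', one_smul]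

end Brouwer

/-! ### Rational balls and semidecidable covers -/

namespace CompMetric

open Metric Set

section

variable {X : Type*} [MetricSpace X] (α : ℕ → X)

/-- The union of a finite list of rational balls. -/
def cover (l : List ℕ) : Set X := ⋃ i ∈ l, ratBall α i

/-- The rational balls with indices `i` and `j` are formally disjoint: the distance of their centres
exceeds the sum of their radii. -/
def FormallyDisjoint (i j : ℕ) : Prop :=
  ((posRat i.unpair.2 : ℝ) + posRat j.unpair.2) < dist (α i.unpair.1) (α j.unpair.1)

variable {α}

theorem mem_cover {l : List ℕ} {x : X} : x ∈ cover α l ↔ ∃ i ∈ l, x ∈ ratBall α i := by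
  simp [cover]

theorem isOpen_ratBall (i : ℕ) : IsOpen (ratBall α i) := isOpen_ball

theorem isOpen_cover (l : List ℕ) : IsOpen (cover α l) :=
  isOpen_biUnion fun i _ => isOpen_ratBall i

theorem cover_append (l m : List ℕ) : cover α (l ++ m) = cover α l ∪ cover α m := by
  ext x
  simp only [mem_cover, List.mem_append, mem_union, or_and_right, exists_or]

theorem cover_cons (i : ℕ) (l : List ℕ) : cover α (i :: l) = ratBall α i ∪ cover α l := by
  ext x
  simp [mem_cover]

theorem FormallyDisjoint.disjoint {i j : ℕ} (h : FormallyDisjoint α i j) :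
    Disjoint (ratBall α i) (ratBall α j) :=
  ball_disjoint_ball h.le

theorem exists_posRat_eq {q : ℚ} (hq : 0 < q) : ∃ k, posRat k = q := by
  refine ⟨Nat.pair (q.num.toNat - 1) (q.den - 1), ?_⟩
  have hn : 0 < q.num := Rat.num_pos.2 hq
  have h1 : ((q.num.toNat - 1 : ℕ) : ℚ) + 1 = q.num := by
    have : q.num.toNat - 1 + 1 = q.num.toNat := by omega
    have h2 : ((q.num.toNat : ℕ) : ℤ) = q.num := Int.toNat_of_nonneg hn.le
    rw [← Nat.cast_succ, Nat.succ_eq_add_one, this]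
    exact_mod_cast congrArg (Int.cast : ℤ → ℚ) h2
  have h2 : ((q.den - 1 : ℕ) : ℚ) + 1 = q.den := by
    have : q.den - 1 + 1 = q.den := by have := q.den_pos; omega
    rw [← Nat.cast_succ, Nat.succ_eq_add_one, this]
  simp only [posRat, Nat.unpair_pair, h1, h2]
  exact Rat.num_div_den q

/-- In a computable metric space formal disjointness of rational balls is r.e. -/
theorem IsComputableMetricSpace.rePred_formallyDisjoint (hX : IsComputableMetricSpace α) :
    REPred fun p : ℕ × ℕ => FormallyDisjoint α p.1 p.2 := by
  obtain ⟨F, ⟨a, b, c, ha, hb, hc, hF⟩, hd⟩ := hX.computable_dist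
  let q : (ℕ × ℕ) × ℕ → (ℕ × ℕ) × ℕ := fun z => ((z.1.1.unpair.1, z.1.2.unpair.1), z.2)
  -- Stage `k` tests whether the approximate distance is at least the sum of the radii plus 1/(k+1),
  -- with denominators cleared. The error 1/(k+1) dominates `2⁻¹ ^ k`.
  let R : ℕ × ℕ → ℕ → Bool := fun p k =>
    let p₁ := p.1.unpair.2.unpair.1 + 1
    let q₁ := p.1.unpair.2.unpair.2 + 1
    let p₂ := p.2.unpair.2.unpair.1 + 1
    let q₂ := p.2.unpair.2.unpair.2 + 1
    decide (c (q (p, k)) % 2 = 0) &&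
      decide ((b (q (p, k)) + 1) * (q₁ * q₂ + (p₁ * q₂ + p₂ * q₁) * (k + 1)) ≤
        a (q (p, k)) * ((k + 1) * (q₁ * q₂)))
  have hadd : Computable₂ ((· + ·) : ℕ → ℕ → ℕ) := Primrec.nat_add.to_comp
  have hmul : Computable₂ ((· * ·) : ℕ → ℕ → ℕ) := Primrec.nat_mul.to_comp
  have hR : Computable₂ R := by
    have hu : ∀ {f : (ℕ × ℕ) × ℕ → ℕ}, Computable f →
        Computable (fun z => (f z).unpair.1) ∧ Computable (fun z => (f z).unpair.2) := fun hf =>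
      ⟨Computable.fst.comp (Computable.unpair.comp hf),
        Computable.snd.comp (Computable.unpair.comp hf)⟩
    have h1 : Computable fun z : (ℕ × ℕ) × ℕ => z.1.1 := Computable.fst.comp Computable.fst
    have h2 : Computable fun z : (ℕ × ℕ) × ℕ => z.1.2 := Computable.snd.comp Computable.fst
    have hq : Computable q := ((hu h1).1.pair (hu h2).1).pair Computable.snd
    have hp₁ := Computable.succ.comp (hu (hu h1).2).1
    have hq₁ := Computable.succ.comp (hu (hu h1).2).2
    have hp₂ := Computable.succ.comp (hu (hu h2).2).1
    have hq₂ := Computable.succ.comp (hu (hu h2).2).2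
    have hk : Computable fun z : (ℕ × ℕ) × ℕ => z.2 + 1 := Computable.succ.comp Computable.snd
    have hqq := hmul.comp hq₁ hq₂
    have hcc : Computable fun z => c (q z) % 2 :=
      Primrec.nat_mod.to_comp.comp (hc.comp hq) (Computable.const 2)
    have hL := hmul.comp (Computable.succ.comp (hb.comp hq))
      (hadd.comp hqq (hmul.comp (hadd.comp (hmul.comp hp₁ hq₂) (hmul.comp hp₂ hq₁)) hk))
    have hr := hmul.comp (ha.comp hq) (hmul.comp hk hqq)
    have e1 : Computable fun z => decide (c (q z) % 2 = 0) :=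
      Primrec.eq.decide.to_comp.comp hcc (Computable.const 0)
    have e2 := Primrec.nat_le.decide.to_comp.comp hL hr
    exact Primrec.and.to_comp.comp e1 e2
  refine (REPred.of_exists_nat hR).of_eq fun p => ?_
  obtain ⟨i, j⟩ := p
  have key : ∀ k, R (i, j) k = true ↔
      (1 : ℝ) / (k + 1) + (posRat i.unpair.2 + posRat j.unpair.2) ≤
        F ((i.unpair.1, j.unpair.1), k) := by
    intro k
    simp only [R, Bool.and_eq_true, decide_eq_true_eq]
    have hFk := hF ((i.unpair.1, j.unpair.1), k)
    change _ = (-1) ^ c (q ((i, j), k)) * ((a (q ((i, j), k)) : ℚ) / (b (q ((i, j), k)) + 1)) at hFk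
    rw [hFk]
    generalize a (q ((i, j), k)) = A
    generalize b (q ((i, j), k)) = B
    generalize c (q ((i, j), k)) = C
    simp only [posRat]
    generalize i.unpair.2.unpair.1 = x
    generalize i.unpair.2.unpair.2 = y
    generalize j.unpair.2.unpair.1 = z
    generalize j.unpair.2.unpair.2 = w
    rcases Nat.even_or_odd C with hC | hC
    · have e : (1 : ℝ) / (k + 1) + ((((x : ℚ) + 1) / ((y : ℚ) + 1) : ℚ) +
          (((z : ℚ) + 1) / ((w : ℚ) + 1) : ℚ)) =
          (((y + 1) * (w + 1) + ((x + 1) * (w + 1) + (z + 1) * (y + 1)) * (k + 1) : ℕ) : ℝ) /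
            (((k + 1) * ((y + 1) * (w + 1)) : ℕ) : ℝ) := by
        push_cast
        field_simp
      rw [e, hC.neg_one_pow, one_mul]
      push_cast [Nat.even_iff.1 hC]
      rw [div_le_div_iff₀ (by positivity) (by positivity), mul_comm _ ((B : ℝ) + 1)]
      simp only [true_and]
      exact_mod_cast Iff.rfl
    -- Odd sign exponent: the approximation is at most 0, so the test rightly fails.
    · have h1 : ¬ C % 2 = 0 := by rw [Nat.odd_iff.1 hC]; norm_num
      simp only [h1, false_and, false_iff, not_le]
      rw [hC.neg_one_pow]
      push_cast
      have h2 : (0 : ℝ) ≤ (A : ℝ) / (B + 1) := by positivity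
      have h3 : (0 : ℝ) < 1 / (k + 1) + ((x + 1) / (y + 1) + (z + 1) / (w + 1)) := by positivity
      linarith
  have hpow : ∀ k : ℕ, (2 : ℝ)⁻¹ ^ k ≤ 1 / (k + 1) := by
    intro k
    rw [inv_pow, ← one_div]
    apply one_div_le_one_div_of_le (by positivity)
    exact_mod_cast Nat.lt_two_pow_self
  simp only [key, FormallyDisjoint]
  constructor
  · rintro ⟨k, hk⟩
    have h1 := (abs_lt.1 (hd (i.unpair.1, j.unpair.1) k)).1
    have h2 := hpow k
    simp only at h1
    linarith
  · intro h
    obtain ⟨k, hk⟩ := exists_nat_one_div_lt (half_pos (sub_pos.2 h))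
    refine ⟨k, ?_⟩
    have h1 := (abs_lt.1 (hd (i.unpair.1, j.unpair.1) k)).2
    have h2 := hpow k
    simp only at h1
    linarith

/-- For a nonempty computably compact set the covers by lists of rational balls form an r.e. set. -/
theorem IsComputablyCompact.rePred_subset_cover {K : Set X} (hK : IsComputablyCompact α K)
    (hne : K.Nonempty) : REPred fun l : List ℕ => K ⊆ cover α l := by
  have h1 : REPred fun z : List ℕ × ℕ × List ℕ => z.1 = z.2.1 :: z.2.2 :=
    ComputablePred.to_re (PrimrecPred.computablePred
      (Primrec.eq.comp Primrec.fst (Primrec.list_cons.comp (Primrec.fst.comp Primrec.snd)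
        (Primrec.snd.comp Primrec.snd))))
  have h2 : REPred fun z : List ℕ × ℕ × List ℕ =>
      K ⊆ ratUnion α (Nat.pair z.2.1 (Encodable.encode z.2.2)) :=
    hK.2.2.comp (Primrec.to_comp (Primrec₂.natPair.comp (Primrec.fst.comp Primrec.snd)
      (Primrec.encode.comp (Primrec.snd.comp Primrec.snd))))
  have h3 : ∀ i t, ratUnion α (Nat.pair i (Encodable.encode t)) = cover α (i :: t) := by
    intro i t
    simp [ratUnion, cover, finSeq]
  refine (h1.and h2).exists.of_eq fun l => ?_
  constructor
  · rintro ⟨⟨i, t⟩, rfl : l = i :: t, h⟩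
    rwa [← h3]
  · intro h
    cases l with
    | nil =>
      -- `finSeq` never yields the empty list, which is harmless because it cannot cover a nonempty
      -- set.
      obtain ⟨x, hx⟩ := hne
      simpa [mem_cover] using h hx
    | cons i t => exact ⟨(i, t), rfl, by rwa [h3]⟩

/-- In a locally computable space, the covers of a nonempty compact co-c.e. set by finite lists of
rational balls form an r.e. set. -/
theorem IsCoCE.rePred_subset_cover (hloc : IsLocallyComputable α) {E : Set X}
    (hE : IsCoCE α E) (hc : IsCompact E) (hne : E.Nonempty) :
    REPred fun l : List ℕ => E ⊆ cover α l := by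
  obtain ⟨K, hK, hEK⟩ := hloc E hc
  obtain ⟨-, A, hA, hEA⟩ := hE
  have h1 : REPred fun z : List ℕ × List ℕ => ∀ i ∈ z.2, i ∈ A := by
    have : REPred fun p : ℕ × Unit => p.1 ∈ A := hA.comp Computable.fst
    exact this.forall_mem_list.comp (Computable.snd.pair (Computable.const ()))
  have h2 : REPred fun z : List ℕ × List ℕ => K ⊆ cover α (z.1 ++ z.2) :=
    (hK.rePred_subset_cover (hne.mono hEK)).comp
      (Computable.list_append.comp Computable.fst Computable.snd)
  refine (h1.and h2).exists.of_eq fun l => ?_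
  constructor
  · rintro ⟨m, hm, h⟩ x hx
    have h3 := h (hEK hx)
    rw [cover_append] at h3
    refine h3.resolve_right fun h4 => ?_
    obtain ⟨i, hi, hxi⟩ := mem_cover.1 h4
    have : x ∈ Eᶜ := by
      rw [hEA]
      exact mem_biUnion (hm i hi) hxi
    exact this hx
  · intro h
    obtain ⟨t, htA, htf, ht⟩ := (hK.1.diff (isOpen_cover l)).elim_finite_subcover_image
      (b := A) (c := ratBall α) (fun i _ => isOpen_ratBall i) (by
        rw [← hEA]
        exact fun x hx hxE => hx.2 (h hxE))
    refine ⟨htf.toFinset.toList, fun i hi => htA (by simpa using hi), fun x hx => ?_⟩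
    rw [cover_append]
    by_cases hxl : x ∈ cover α l
    · exact Or.inl hxl
    · obtain ⟨i, hi, hxi⟩ := mem_iUnion₂.1 (ht ⟨hx, hxl⟩)
      exact Or.inr (mem_cover.2 ⟨i, by simpa using hi, hxi⟩)

/-- A compact set is covered by finitely many arbitrarily small rational balls that meet it. -/
theorem exists_cover_of_isCompact (hα : DenseRange α) {A : Set X} (hA : IsCompact A) {δ : ℝ}
    (hδ : 0 < δ) : ∃ l : List ℕ, A ⊆ cover α l ∧
      ∀ i ∈ l, (posRat i.unpair.2 : ℝ) < δ ∧ (ratBall α i ∩ A).Nonempty := by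
  obtain ⟨q, hq0, hqδ⟩ := exists_rat_btwn hδ
  obtain ⟨k, rfl⟩ := exists_posRat_eq (by exact_mod_cast hq0 : 0 < q)
  have hc : ∀ x ∈ A, ∃ i : ℕ, i.unpair.2 = k ∧ x ∈ ratBall α i := by
    intro x _
    obtain ⟨m, hm⟩ := hα.exists_dist_lt x hq0
    exact ⟨Nat.pair m k, by simp, by simpa [ratBall] using hm⟩
  obtain ⟨t, htA, htf, ht⟩ := hA.elim_finite_subcover_image
    (b := {i : ℕ | i.unpair.2 = k ∧ (ratBall α i ∩ A).Nonempty}) (c := ratBall α)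
    (fun i _ => isOpen_ratBall i) (fun x hx => by
      obtain ⟨i, hi, hxi⟩ := hc x hx
      exact mem_biUnion ⟨hi, x, hxi, hx⟩ hxi)
  refine ⟨htf.toFinset.toList, fun x hx => ?_, fun i hi => ?_⟩
  · obtain ⟨i, hi, hxi⟩ := mem_iUnion₂.1 (ht hx)
    exact mem_cover.2 ⟨i, by simpa using hi, hxi⟩
  · obtain ⟨h1, h2⟩ := htA (show i ∈ t by simpa using hi)
    exact ⟨h1 ▸ hqδ, h2⟩

/-- Each ball costs its radius twice, once from point to centre and once in the sum of radii; hence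
the factor 4. -/
theorem formallyDisjoint_of_le_dist {A B : Set X} {δ : ℝ} (hAB : ∀ x ∈ A, ∀ y ∈ B, 4 * δ ≤ dist x y)
    {i j : ℕ} (hi : (posRat i.unpair.2 : ℝ) < δ) (hiA : (ratBall α i ∩ A).Nonempty)
    (hj : (posRat j.unpair.2 : ℝ) < δ) (hjB : (ratBall α j ∩ B).Nonempty) :
    FormallyDisjoint α i j := by
  obtain ⟨x, hxi, hx⟩ := hiA
  obtain ⟨y, hyj, hy⟩ := hjB
  have h1 := hAB x hx y hy
  have h2 : dist x (α i.unpair.1) < posRat i.unpair.2 := hxi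
  have h3 : dist y (α j.unpair.1) < posRat j.unpair.2 := hyj
  have h4 := dist_triangle4 x (α i.unpair.1) (α j.unpair.1) y
  rw [dist_comm (α j.unpair.1) y] at h4
  unfold FormallyDisjoint
  linarith

end

/-! ### Signed coordinates and a field with one zero -/

section

variable {n : ℕ}

/-- The face of the cube opposite to a given one; a face is given by a coordinate and a sign. -/
def oppFace (κ : Fin n × Bool) : Fin n × Bool := (κ.1, !κ.2)

/-- The coordinate, with sign, that belongs to a face of the cube. -/
def signedCoord (κ : Fin n × Bool) (v : EuclideanSpace ℝ (Fin n)) : ℝ :=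
  if κ.2 then v κ.1 else -v κ.1

theorem signedCoord_oppFace (κ : Fin n × Bool) (v : EuclideanSpace ℝ (Fin n)) :
    signedCoord (oppFace κ) v = -signedCoord κ v := by
  rcases κ with ⟨k, _ | _⟩ <;> simp [signedCoord, oppFace]

theorem signedCoord_neg_smul (κ : Fin n × Bool) (t : ℝ) (v : EuclideanSpace ℝ (Fin n)) :
    signedCoord κ (-(t • v)) = -(t * signedCoord κ v) := by
  rcases κ with ⟨k, _ | _⟩ <;> simp [signedCoord]

theorem continuous_signedCoord (κ : Fin n × Bool) :
    Continuous (signedCoord κ : EuclideanSpace ℝ (Fin n) → ℝ) := by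
  unfold signedCoord
  split_ifs <;> fun_prop

/-- The norm is at most the sum of the `n` absolute coordinates. This is the source of the constant
`1 / n` for faces. -/
theorem exists_norm_div_le_signedCoord (hn : 1 ≤ n) (v : EuclideanSpace ℝ (Fin n)) :
    ∃ κ, ‖v‖ / n ≤ signedCoord κ v := by
  by_contra! h
  have h1 : ∀ k, |v k| < ‖v‖ / n := fun k =>
    abs_lt.2 ⟨by have := h (k, false); simp [signedCoord] at this; linarith,
      by simpa [signedCoord] using h (k, true)⟩
  have h2 : ‖v‖ ≤ ∑ k, |v k| := by
    conv_lhs => rw [← (EuclideanSpace.basisFun (Fin n) ℝ).sum_repr v]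
    refine (norm_sum_le _ _).trans (Finset.sum_le_sum fun k _ => ?_)
    rw [norm_smul, (EuclideanSpace.basisFun (Fin n) ℝ).orthonormal.1 k]
    simp
  have : Nonempty (Fin n) := ⟨⟨0, hn⟩⟩
  have h3 : ∑ k, |v k| < ∑ _k : Fin n, ‖v‖ / n :=
    Finset.sum_lt_sum_of_nonempty Finset.univ_nonempty fun k _ => h1 k
  have hn' : (n : ℝ) ≠ 0 := by positivity
  rw [Finset.sum_const, Finset.card_univ, Fintype.card_fin, nsmul_eq_mul,
    mul_div_cancel₀ _ hn'] at h3
  linarith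

/-- A vector field on the ball that vanishes only at the interior point `p` and is the identity on
the sphere. -/
theorem exists_continuous_eq_zero_iff {V : Type*} [NormedAddCommGroup V] [InnerProductSpace ℝ V]
    {p : V} (hp : ‖p‖ < 1) : ∃ g : V → V, Continuous g ∧ (∀ x, ‖x‖ = 1 → g x = x) ∧
      ∀ x, ‖x‖ ≤ 1 → g x = 0 → x = p := by
  have hp' : 0 < 1 - ‖p‖ ^ 2 := by nlinarith [norm_nonneg p]
  refine ⟨fun x => x - ((1 - ‖x‖ ^ 2) / (1 - ‖p‖ ^ 2)) • p, by fun_prop, ?_, ?_⟩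
  · intro x hx
    simp [hx]
  · intro x hx h
    set s := (1 - ‖x‖ ^ 2) / (1 - ‖p‖ ^ 2) with hs
    have hs0 : 0 ≤ s := div_nonneg (by nlinarith [norm_nonneg x]) hp'.le
    have hxs : x = s • p := sub_eq_zero.1 h
    have h1 : s * (1 - ‖p‖ ^ 2) = 1 - ‖x‖ ^ 2 := div_mul_cancel₀ _ hp'.ne'
    have h2 : ‖x‖ ^ 2 = s ^ 2 * ‖p‖ ^ 2 := by
      conv_lhs => rw [hxs]
      rw [norm_smul, mul_pow, Real.norm_eq_abs, sq_abs]
    -- A zero has the form `s • p` with `s ≥ 0`; substitution leaves this factorization, whose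
    -- second factor is positive.
    have h3 : (s - 1) * (s * ‖p‖ ^ 2 + 1) = 0 := by
      rw [h2] at h1
      linear_combination h1
    have h4 : s = 1 := by
      have : s * ‖p‖ ^ 2 + 1 ≠ 0 := by positivity
      linarith [(mul_eq_zero.1 h3).resolve_right this]
    rw [hxs, h4, one_smul]

end

/-! ### Labelled covers as witnesses of intersection -/

section

variable {X : Type*} [MetricSpace X] (α : ℕ → X) {n : ℕ}

/-- A list of rational balls labelled by the faces of the cube that, together with the ball of index
`i`, covers `E`; balls with opposite labels are formally disjoint, and balls labelled by the face
opposite to `κ` are formally disjoint from a cover of the part of `S` not covered by `C κ`. -/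
def SeparatesFaces (E S : Set X) (C : Fin n × Bool → List ℕ) (i : ℕ)
    (l : List (ℕ × (Fin n × Bool))) : Prop :=
  E ⊆ cover α (i :: l.map Prod.fst) ∧
    (∀ a ∈ l, ∀ b ∈ l, b.2 = oppFace a.2 → FormallyDisjoint α a.1 b.1) ∧
    ∀ κ, ∃ J : List ℕ, S ⊆ cover α (J ++ C κ) ∧
      ∀ j ∈ J, ∀ a ∈ l, a.2 = oppFace κ → FormallyDisjoint α j a.1

variable {α}

theorem rePred_separatesFaces (hX : IsComputableMetricSpace α) {E S : Set X}
    (hE : REPred fun l : List ℕ => E ⊆ cover α l) (hS : REPred fun l : List ℕ => S ⊆ cover α l)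
    (C : Fin n × Bool → List ℕ) :
    REPred fun p : ℕ × List (ℕ × (Fin n × Bool)) => SeparatesFaces α E S C p.1 p.2 := by
  have hfd := hX.rePred_formallyDisjoint
  have hopp : Primrec (oppFace : Fin n × Bool → Fin n × Bool) := Primrec.dom_finite _
  have h1 : REPred fun p : ℕ × List (ℕ × (Fin n × Bool)) =>
      E ⊆ cover α (p.1 :: p.2.map Prod.fst) :=
    hE.comp (Primrec.to_comp (Primrec.list_cons.comp Primrec.fst
      (Primrec.list_map Primrec.snd (Primrec.fst.comp Primrec.snd).to₂)))
  have h2 : REPred fun p : ℕ × List (ℕ × (Fin n × Bool)) =>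
      ∀ a ∈ p.2, ∀ b ∈ p.2, b.2 = oppFace a.2 → FormallyDisjoint α a.1 b.1 := by
    have e1 : REPred fun z : (ℕ × (Fin n × Bool)) × (ℕ × (Fin n × Bool)) =>
        ¬ z.2.2 = oppFace z.1.2 :=
      REPred.ne (Primrec.snd.comp Primrec.snd) (hopp.comp (Primrec.snd.comp Primrec.fst))
    have e2 : REPred fun z : (ℕ × (Fin n × Bool)) × (ℕ × (Fin n × Bool)) =>
        FormallyDisjoint α z.1.1 z.2.1 :=
      hfd.comp₂ (Computable.fst.comp Computable.fst) (Computable.fst.comp Computable.snd)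
    have e3 := ((e1.or e2).of_eq fun z => imp_iff_not_or.symm).forall_mem_list₂
    exact REPred.comp₂ (p := fun l m : List (ℕ × (Fin n × Bool)) =>
      ∀ a ∈ l, ∀ b ∈ m, b.2 = oppFace a.2 → FormallyDisjoint α a.1 b.1) e3 Computable.snd
      Computable.snd
  have h3 : ∀ κ, REPred fun p : ℕ × List (ℕ × (Fin n × Bool)) => ∃ J : List ℕ,
      S ⊆ cover α (J ++ C κ) ∧
        ∀ j ∈ J, ∀ a ∈ p.2, a.2 = oppFace κ → FormallyDisjoint α j a.1 := by
    intro κ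
    have e1 : REPred fun z : ℕ × (ℕ × (Fin n × Bool)) => ¬ z.2.2 = oppFace κ :=
      REPred.ne (Primrec.snd.comp Primrec.snd) (Primrec.const _)
    have e2 : REPred fun z : ℕ × (ℕ × (Fin n × Bool)) => FormallyDisjoint α z.1 z.2.1 :=
      hfd.comp₂ Computable.fst (Computable.fst.comp Computable.snd)
    have e3 := ((e1.or e2).of_eq fun z => imp_iff_not_or.symm).forall_mem_list₂
    have e4 : REPred fun z : (ℕ × List (ℕ × (Fin n × Bool))) × List ℕ =>
        S ⊆ cover α (z.2 ++ C κ) :=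
      hS.comp (Computable.list_append.comp Computable.snd (Computable.const _))
    have e5 : REPred fun z : (ℕ × List (ℕ × (Fin n × Bool))) × List ℕ =>
        ∀ j ∈ z.2, ∀ a ∈ z.1.2, a.2 = oppFace κ → FormallyDisjoint α j a.1 :=
      REPred.comp₂ (p := fun (J : List ℕ) (l : List (ℕ × (Fin n × Bool))) =>
        ∀ j ∈ J, ∀ a ∈ l, a.2 = oppFace κ → FormallyDisjoint α j a.1) e3 Computable.snd
        (Computable.snd.comp Computable.fst)
    exact (e4.and e5).exists
  exact h1.and (h2.and (REPred.forall_fintype h3))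

/-- If `E` is covered as in `SeparatesFaces`, then `E` meets the distinguished ball, since otherwise
the cover yields a vector field on the ball without zeros that contradicts Brouwer's theorem. -/
theorem SeparatesFaces.inter_ratBall_nonempty {E : Set X} {f : UnitBall n ≃ₜ E}
    {C : Fin n × Bool → List ℕ} (hn : 1 ≤ n)
    (hC : ∀ κ (x : UnitBall n), ‖(x : EuclideanSpace ℝ (Fin n))‖ = 1 →
      1 / (n : ℝ) ≤ signedCoord κ x → (f x : X) ∉ cover α (C κ))
    {i : ℕ} {l : List (ℕ × (Fin n × Bool))} (h : SeparatesFaces α E (boundarySphere f) C i l) :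
    (E ∩ ratBall α i).Nonempty := by
  classical
  obtain ⟨hcov, hdis, hsph⟩ := h
  by_contra hemp
  -- `φ κ` is positive exactly on the union of the balls labelled `κ`.
  let φ : Fin n × Bool → X → ℝ := fun κ y =>
    ∑ a ∈ l.toFinset with a.2 = κ, max 0 ((posRat a.1.unpair.2 : ℝ) - dist y (α a.1.unpair.1))
  have hφc : ∀ κ, Continuous (φ κ) := fun κ => by
    simp only [φ]; fun_prop
  have hφ0 : ∀ κ y, 0 ≤ φ κ y := fun κ y => Finset.sum_nonneg fun a _ => le_max_left _ _
  have hφpos : ∀ a ∈ l, ∀ y ∈ ratBall α a.1, 0 < φ a.2 y := by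
    intro a ha y hy
    refine Finset.sum_pos' (fun b _ => le_max_left _ _) ⟨a, by simpa using ha, ?_⟩
    exact lt_max_of_lt_right (sub_pos.2 hy)
  have hφzero : ∀ κ y, (∀ a ∈ l, a.2 = κ → y ∉ ratBall α a.1) → φ κ y = 0 := by
    intro κ y hy
    refine Finset.sum_eq_zero fun a ha => ?_
    rw [Finset.mem_filter, List.mem_toFinset] at ha
    have := hy a ha.1 ha.2
    simp only [ratBall, mem_ball, not_lt] at this
    exact max_eq_left (sub_nonpos.2 this)
  let h : UnitBall n → EuclideanSpace ℝ (Fin n) := fun x =>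
    WithLp.toLp 2 fun k => φ (k, true) (f x) - φ (k, false) (f x)
  have hsigned : ∀ κ x, signedCoord κ (h x) = φ κ (f x) - φ (oppFace κ) (f x) := by
    rintro ⟨k, _ | _⟩ x <;> simp [signedCoord, h, oppFace]
  have hhc : Continuous h := by
    have hf : Continuous fun x => (f x : X) := continuous_subtype_val.comp f.continuous
    refine (PiLp.continuous_toLp 2 _).comp (continuous_pi fun k => ?_)
    exact ((hφc _).comp hf).sub ((hφc _).comp hf)
  -- On the sphere choose `κ` with coordinate at least `1 / n`. Then `f x` avoids `C κ`, hence lies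
  -- in `J` and in no ball with the opposite label: the `κ`-coordinate of `h x` is nonnegative,
  -- while that of `-(t • x)` is negative.
  obtain ⟨x, hx⟩ := exists_eq_zero_of_forall_ne_neg_smul hhc fun x hx t ht heq => by
    obtain ⟨κ, hκ⟩ := exists_norm_div_le_signedCoord hn (x : EuclideanSpace ℝ (Fin n))
    rw [hx] at hκ
    obtain ⟨J, hJ, hJd⟩ := hsph κ
    have hxJ := hJ (show (f x : X) ∈ boundarySphere f from ⟨x, hx, rfl⟩)
    rw [cover_append] at hxJ
    obtain ⟨j, hj, hxj⟩ := mem_cover.1 (hxJ.resolve_right (hC κ x hx hκ))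
    have h0 : φ (oppFace κ) (f x) = 0 := hφzero _ _ fun a ha haκ hxa =>
      disjoint_left.1 (hJd j hj a ha haκ).disjoint hxj hxa
    have h1 := hsigned κ x
    rw [heq, signedCoord_neg_smul, h0, sub_zero] at h1
    have h2 : 0 < t * signedCoord κ (x : EuclideanSpace ℝ (Fin n)) :=
      mul_pos ht (lt_of_lt_of_le (by positivity) hκ)
    linarith [hφ0 κ (f x)]
  have hxE := hcov (f x).2
  rw [cover_cons] at hxE
  have hxi : (f x : X) ∉ ratBall α i := fun hxi => hemp ⟨f x, (f x).2, hxi⟩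
  obtain ⟨m, hm, hxm⟩ := mem_cover.1 (hxE.resolve_left hxi)
  obtain ⟨a, ha, rfl⟩ := List.mem_map.1 hm
  have h0 : φ (oppFace a.2) (f x) = 0 := hφzero _ _ fun b hb hba hxb =>
    disjoint_left.1 (hdis a ha b hb hba).disjoint hxm hxb
  have h1 := hsigned a.2 x
  rw [hx, h0, sub_zero] at h1
  have h2 : signedCoord a.2 (0 : EuclideanSpace ℝ (Fin n)) = 0 := by simp [signedCoord]
  linarith [hφpos a ha _ hxm]

/-- Stated for all small `δ` so that finitely many separations can share one `δ`. -/
theorem eventually_forall_le_dist {A B : Set X} (hA : IsCompact A) (hB : IsCompact B)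
    (hAB : Disjoint A B) :
    ∀ᶠ δ in nhdsWithin (0 : ℝ) (Ioi 0), ∀ x ∈ A, ∀ y ∈ B, 4 * δ ≤ dist x y := by
  obtain ⟨r, hr, h⟩ := Metric.exists_pos_forall_lt_edist hA hB.isClosed hAB
  have hr' : (0 : ℝ) < r / 4 := by positivity
  filter_upwards [Ioo_mem_nhdsGT hr'] with δ hδ x hx y hy
  have h1 := h x hx y hy
  rw [edist_nndist, ENNReal.coe_lt_coe] at h1
  have h2 : (r : ℝ) < dist x y := by exact_mod_cast h1
  linarith [hδ.2]

/-- Finitely many rational balls cover the half of the boundary sphere away from a face, and miss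
that face. -/
theorem exists_cover_away_from_face (hα : DenseRange α) {E : Set X} (f : UnitBall n ≃ₜ E)
    (κ : Fin n × Bool) {c : ℝ} (hc : 0 < c) : ∃ C : List ℕ,
      (∀ x : UnitBall n, ‖(x : EuclideanSpace ℝ (Fin n))‖ = 1 → signedCoord κ x ≤ 0 →
        (f x : X) ∈ cover α C) ∧
      ∀ x : UnitBall n, ‖(x : EuclideanSpace ℝ (Fin n))‖ = 1 → c ≤ signedCoord κ x →
        (f x : X) ∉ cover α C := by
  have hf : Continuous fun x => (f x : X) := continuous_subtype_val.comp f.continuous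
  have hs : Continuous fun x : UnitBall n => signedCoord κ (x : EuclideanSpace ℝ (Fin n)) :=
    (continuous_signedCoord κ).comp continuous_subtype_val
  have hN : IsClosed {x : UnitBall n | ‖(x : EuclideanSpace ℝ (Fin n))‖ = 1} :=
    isClosed_eq (continuous_norm.comp continuous_subtype_val) continuous_const
  have hA : IsCompact ((fun x => (f x : X)) ''
      ({x : UnitBall n | ‖(x : EuclideanSpace ℝ (Fin n))‖ = 1} ∩ {x | signedCoord κ x ≤ 0})) :=
    (hN.inter (isClosed_le hs continuous_const)).isCompact.image hf
  have hB : IsCompact ((fun x => (f x : X)) ''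
      ({x : UnitBall n | ‖(x : EuclideanSpace ℝ (Fin n))‖ = 1} ∩ {x | c ≤ signedCoord κ x})) :=
    (hN.inter (isClosed_le continuous_const hs)).isCompact.image hf
  have hAB : Disjoint ((fun x => (f x : X)) ''
      ({x : UnitBall n | ‖(x : EuclideanSpace ℝ (Fin n))‖ = 1} ∩ {x | signedCoord κ x ≤ 0}))
      ((fun x => (f x : X)) ''
      ({x : UnitBall n | ‖(x : EuclideanSpace ℝ (Fin n))‖ = 1} ∩ {x | c ≤ signedCoord κ x})) := by
    rw [disjoint_left]
    rintro _ ⟨x, ⟨-, hx⟩, rfl⟩ ⟨y, ⟨-, hy⟩, hxy⟩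
    have : y = x := f.injective (Subtype.ext hxy)
    subst this
    have hx' : signedCoord κ (y : EuclideanSpace ℝ (Fin n)) ≤ 0 := hx
    have hy' : c ≤ signedCoord κ (y : EuclideanSpace ℝ (Fin n)) := hy
    linarith
  obtain ⟨δ, hδ, hδ0⟩ := ((eventually_forall_le_dist hA hB hAB).and
    (self_mem_nhdsWithin : Ioi (0 : ℝ) ∈ _)).exists
  obtain ⟨l, hl, hl'⟩ := exists_cover_of_isCompact hα hA hδ0
  refine ⟨l, fun x hx hxκ => hl ⟨x, ⟨hx, hxκ⟩, rfl⟩, fun x hx hxκ hxl => ?_⟩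
  obtain ⟨i, hi, hxi⟩ := mem_cover.1 hxl
  obtain ⟨hr, y, hyi, hy⟩ := hl' i hi
  have h1 := hδ y hy _ ⟨x, ⟨hx, hxκ⟩, rfl⟩
  have h2 : dist y (α i.unpair.1) < posRat i.unpair.2 := hyi
  have h3 : dist (f x : X) (α i.unpair.1) < posRat i.unpair.2 := hxi
  have h4 := dist_triangle_right y (f x : X) (α i.unpair.1)
  have h5 : (0 : ℝ) < δ := hδ0
  simp only at h1
  linarith

/-- Move slightly towards the centre along a radius: the field with a single zero needs an interior
point. -/
theorem exists_norm_lt_one_mem {E : Set X} (f : UnitBall n ≃ₜ E) {U : Set X} (hU : IsOpen U)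
    (h : (E ∩ U).Nonempty) :
    ∃ p : UnitBall n, ‖(p : EuclideanSpace ℝ (Fin n))‖ < 1 ∧ (f p : X) ∈ U := by
  obtain ⟨y, hyE, hyU⟩ := h
  obtain ⟨x, hx⟩ := f.surjective ⟨y, hyE⟩
  have hx1 : ‖(x : EuclideanSpace ℝ (Fin n))‖ ≤ 1 := mem_closedBall_zero_iff.1 x.2
  let γ : unitInterval → UnitBall n := fun t => ⟨(t : ℝ) • (x : EuclideanSpace ℝ (Fin n)), by
    rw [mem_closedBall_zero_iff, norm_smul, Real.norm_of_nonneg t.2.1]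
    exact mul_le_one₀ t.2.2 (norm_nonneg _) hx1⟩
  have hγ : Continuous γ := by fun_prop
  have hV : IsOpen ((fun t => (f (γ t) : X)) ⁻¹' U) :=
    hU.preimage (continuous_subtype_val.comp (f.continuous.comp hγ))
  have h1 : (1 : unitInterval) ∈ (fun t => (f (γ t) : X)) ⁻¹' U := by
    have : γ 1 = x := Subtype.ext (by simp [γ])
    simpa [this, hx] using hyU
  have h2 : (1 : unitInterval) ∈ closure (Iio 1) := by
    rw [closure_Iio' ⟨0, by simp⟩]
    simp
  obtain ⟨t, htU, ht1⟩ := mem_closure_iff.1 h2 _ hV h1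
  refine ⟨γ t, ?_, htU⟩
  have ht1' : (t : ℝ) < 1 := ht1
  simp only [γ]
  rw [norm_smul, Real.norm_of_nonneg t.2.1]
  nlinarith [t.2.1, norm_nonneg (x : EuclideanSpace ℝ (Fin n))]

theorem exists_separatesFaces (hα : DenseRange α) {E : Set X} (f : UnitBall n ≃ₜ E)
    {C : Fin n × Bool → List ℕ} (hn : 1 ≤ n)
    (hC : ∀ κ (x : UnitBall n), ‖(x : EuclideanSpace ℝ (Fin n))‖ = 1 →
      signedCoord κ x ≤ 0 → (f x : X) ∈ cover α (C κ))
    (hS : IsCompact (boundarySphere f)) {i : ℕ} (hi : (E ∩ ratBall α i).Nonempty) :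
    ∃ l, SeparatesFaces α E (boundarySphere f) C i l := by
  have hf : Continuous fun x => (f x : X) := continuous_subtype_val.comp f.continuous
  obtain ⟨p, hp1, hpi⟩ := exists_norm_lt_one_mem f (isOpen_ratBall i) hi
  obtain ⟨g, hgc, hgS, hg0⟩ := exists_continuous_eq_zero_iff hp1
  have hgc' : Continuous fun x : UnitBall n => g x := hgc.comp continuous_subtype_val
  let Q : Set (UnitBall n) := {x | (f x : X) ∉ ratBall α i}
  have hQ : IsClosed Q := (isOpen_ratBall i).isClosed_compl.preimage hf
  obtain ⟨ε, hε, hεQ⟩ : ∃ ε : ℝ, 0 < ε ∧ ∀ x ∈ Q, ε ≤ ‖g x‖ := by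
    refine hQ.isCompact.exists_forall_le' (f := fun x : UnitBall n => ‖g x‖)
      hgc'.norm.continuousOn (a := 0) fun x hx => norm_pos_iff.2 fun h0 => ?_
    have : x = p := Subtype.ext (hg0 x (mem_closedBall_zero_iff.1 x.2) h0)
    exact hx (this ▸ hpi)
  have hn' : (0 : ℝ) < n := by exact_mod_cast hn
  -- Points outside `ratBall α i` where coordinate `κ` of `g` is large. These sets exhaust the image
  -- of `Q`, and opposite ones are disjoint because their coordinates are negatives of each other.
  let W : Fin n × Bool → Set X := fun κ =>
    (fun x => (f x : X)) '' (Q ∩ {x | ε / n ≤ signedCoord κ (g x)})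
  have hW : ∀ κ, IsCompact (W κ) := fun κ =>
    (hQ.inter (isClosed_le continuous_const
      ((continuous_signedCoord κ).comp hgc'))).isCompact.image hf
  have hWW : ∀ κ, Disjoint (W κ) (W (oppFace κ)) := by
    intro κ
    rw [disjoint_left]
    rintro _ ⟨x, ⟨-, hx⟩, rfl⟩ ⟨y, ⟨-, hy⟩, hxy⟩
    have : y = x := f.injective (Subtype.ext hxy)
    subst this
    have hx' : ε / n ≤ signedCoord κ (g y) := hx
    have hy' : ε / n ≤ signedCoord (oppFace κ) (g y) := hy
    rw [signedCoord_oppFace] at hy'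
    linarith [div_pos hε hn']
  let G : Fin n × Bool → Set X := fun κ => boundarySphere f \ cover α (C κ)
  have hG : ∀ κ, IsCompact (G κ) := fun κ => hS.diff (isOpen_cover _)
  -- On the sphere `g` is the identity, so a point of `W (oppFace κ)` has negative `κ`-coordinate
  -- and is already covered by `C κ`.
  have hGW : ∀ κ, Disjoint (G κ) (W (oppFace κ)) := by
    intro κ
    rw [disjoint_left]
    rintro _ ⟨⟨x, hx1, rfl⟩, hxC⟩ ⟨y, ⟨-, hy⟩, hxy⟩
    have : y = x := f.injective (Subtype.ext hxy)
    subst this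
    have hy' : ε / n ≤ signedCoord (oppFace κ) (g y) := hy
    rw [signedCoord_oppFace, hgS _ hx1] at hy'
    exact hxC (hC κ y hx1 (by linarith [div_pos hε hn']))
  obtain ⟨δ, hδ, hδ0⟩ := ((Filter.eventually_all.2 fun κ =>
    (eventually_forall_le_dist (hW κ) (hW (oppFace κ)) (hWW κ)).and
      (eventually_forall_le_dist (hG κ) (hW (oppFace κ)) (hGW κ))).and
    (self_mem_nhdsWithin : Ioi (0 : ℝ) ∈ _)).exists
  choose L hL hL' using fun κ => exists_cover_of_isCompact hα (hW κ) hδ0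
  choose J hJ hJ' using fun κ => exists_cover_of_isCompact hα (hG κ) hδ0
  let l : List (ℕ × (Fin n × Bool)) :=
    Finset.univ.toList.flatMap fun κ => (L κ).map fun m => (m, κ)
  have hl : ∀ a, a ∈ l ↔ a.1 ∈ L a.2 := by
    rintro ⟨m, κ⟩
    simp [l]
  refine ⟨l, ?_, ?_, fun κ => ⟨J κ, ?_, ?_⟩⟩
  · intro y hy
    rw [cover_cons]
    by_cases hyi : y ∈ ratBall α i
    · exact Or.inl hyi
    · right
      obtain ⟨x, hx⟩ := f.surjective ⟨y, hy⟩
      have hxy : (f x : X) = y := by rw [hx]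
      have hxQ : x ∈ Q := by simpa [Q, hxy] using hyi
      obtain ⟨κ, hκ⟩ := exists_norm_div_le_signedCoord hn (g x)
      have hyW : y ∈ W κ := ⟨x, ⟨hxQ, le_trans (by gcongr; exact hεQ x hxQ) hκ⟩, hxy⟩
      obtain ⟨m, hm, hym⟩ := mem_cover.1 (hL κ hyW)
      exact mem_cover.2 ⟨m, List.mem_map.2 ⟨(m, κ), (hl _).2 hm, rfl⟩, hym⟩
  · intro a ha b hb hba
    have ha' := hL' a.2 a.1 ((hl a).1 ha)
    have hb' := hL' b.2 b.1 ((hl b).1 hb)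
    rw [hba] at hb'
    exact formallyDisjoint_of_le_dist (hδ a.2).1 ha'.1 ha'.2 hb'.1 hb'.2
  · intro y hy
    rw [cover_append]
    by_cases hyC : y ∈ cover α (C κ)
    · exact Or.inr hyC
    · exact Or.inl (hJ κ ⟨hy, hyC⟩)
  · intro j hj a ha haκ
    have hj' := hJ' κ j hj
    have ha' := hL' a.2 a.1 ((hl a).1 ha)
    rw [haκ] at ha'
    exact formallyDisjoint_of_le_dist (hδ κ).2 hj'.1 hj'.2 ha'.1 ha'.2

end

end CompMetric

/-! ### The main theorem -/

theorem theorem4p9 {X : Type*} [MetricSpace X] (α : ℕ → X)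
    (hX : CompMetric.IsComputableMetricSpace α) (hloc : CompMetric.IsLocallyComputable α)
    (n : ℕ) (hn : 1 ≤ n) (E : Set X) (f : CompMetric.UnitBall n ≃ₜ E)
    (hE : CompMetric.IsCoCE α E) (hS : CompMetric.IsCoCE α (CompMetric.boundarySphere f)) :
    CompMetric.IsComputableSet α E := by
  have hEc : IsCompact E := isCompact_iff_compactSpace.2 f.compactSpace
  have hSE : CompMetric.boundarySphere f ⊆ E := by
    rintro _ ⟨y, -, rfl⟩
    exact (f y).2
  have hSc : IsCompact (CompMetric.boundarySphere f) := hEc.of_isClosed_subset hS.1 hSE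
  have hSne : (CompMetric.boundarySphere f).Nonempty := by
    have hv : ‖EuclideanSpace.single (⟨0, hn⟩ : Fin n) (1 : ℝ)‖ = 1 := by simp
    exact ⟨_, ⟨EuclideanSpace.single ⟨0, hn⟩ 1, mem_closedBall_zero_iff.2 hv.le⟩, hv, rfl⟩
  have hn' : (0 : ℝ) < 1 / n := by
    have : (0 : ℝ) < n := by exact_mod_cast hn
    positivity
  -- `C` is finite data independent of `i`; it only has to exist, not to be computed from `E`.
  choose C hC hC' using fun κ =>
    CompMetric.exists_cover_away_from_face hX.dense f κ hn'
  refine ⟨⟨hE.1, ?_⟩, hE⟩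
  refine (CompMetric.rePred_separatesFaces hX
    (hE.rePred_subset_cover hloc hEc (hSne.mono hSE))
    (hS.rePred_subset_cover hloc hSc hSne) C).exists.of_eq fun i => ?_
  exact ⟨fun ⟨_, h⟩ => h.inter_ratBall_nonempty hn hC',
    fun h => CompMetric.exists_separatesFaces hX.dense f hn hC hSc h⟩
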